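/- A machine has a state $X(t)\in\{0,1,2\}$ (free, busy with an internal job, busy with an external job). Internal jobs arrive at rate $\alpha>0$ while $X=0$ and move $X$ to $1$; internal jobs are completed at rate $\beta>0$ and external jobs at rate $\gamma>0$, which moves $X$ back to $0$. A resource allocator (RA) keeps an estimate $\hat X(t)$ of $X(t)$ and samples the machine at rate $\mu\ge 0$; a sample sets $\hat X$ to $X$. External job requests arrive at the RA at rate $\lambda>0$ and are accepted if $\hat X=0$ and rejected (without effect) if $\hat X\neq 0$. An accepted request is assigned to the machine: if $X=0$, then $X$ and $\hat X$ become $2$; if $X=1$, the request is lost (a false acceptance), and $\hat X$ becomes $1$. A false rejection is a rejection while $X=0$. All event times are exponential and independent, so that $Y=(X,\hat X)$ is a continuous-time Markov chain on $S=\{0,1\}\times\{0,1\}\cup\{0,1,2\}\times\{2\}$; let $X(0)=\hat X(0)=0$. Let $N_A(T),N_{FA}(T),N_R(T),N_{FR}(T)$ be the numbers of acceptances, false acceptances, rejections and false rejections by time $T$, and $$\mathrm{FAR}=\mathbb E\Big[\limsup_{T\to\infty}\frac{N_{FA}(T)}{N_A(T)}\Big],\qquad \mathrm{FRR}=\mathbb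 E\Big[\limsup_{T\to\infty}\frac{N_{FR}(T)}{N_R(T)}\Big].$$ Put $\kappa=\lambda+\alpha+\beta$ and $\tilde\beta=\lambda\beta(\lambda+\beta)+\gamma(\lambda\beta+\lambda\alpha+\alpha\kappa)$. Theorem: when $\mu=0$, the chain $Y$ is not recurrent, and nevertheless the FAR and the FRR of the system with $\mu=0$ are the limits of the closed forms of these ratios for sampling rates $\mu>0$: $$\mathrm{FAR}=\lim_{\mu\to0^+}\frac{\alpha}{\mu+\kappa}=\frac{\alpha}{\kappa},\qquad \mathrm{FRR}=\lim_{\mu\to0^+}\frac{\gamma\beta(\mu(\lambda+\alpha)+\lambda\kappa)}{(\alpha\gamma+\lambda\beta)\mu^2+\tilde\beta\mu+\gamma\lambda(\beta+\alpha)\kappa}=\frac{\beta}{\alpha+\beta}.$$ -/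

import Mathlib

open MeasureTheory ProbabilityTheory Filter Topology

noncomputable section

namespace MarkovMachine

/-- The rates of a single Markov machine monitored by a resource allocator (RA): internal jobs
arrive at rate `alpha` while the machine is free, internal jobs are completed at rate `beta`,
external jobs are completed at rate `gamma`, external job requests arrive at the RA at rate `lam`,
and the RA samples the machine at rate `mu` (where `mu = 0` means that it never samples). -/
structure Rates where
  alpha : ℝ
  beta : ℝ
  gamma : ℝ
  lam : ℝ
  mu : ℝ
  alpha_pos : 0 < alpha
  beta_pos : 0 < beta
  gamma_pos : 0 < gamma
  lam_pos : 0 < lam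
  mu_nonneg : 0 ≤ mu

/-- The state space `S = {0,1} × {0,1} ∪ {0,1,2} × {2}` of the pair `(X, X̂)`: `X` is the state of
the machine (`0` free, `1` busy with an internal job, `2` busy with an external job), and `X̂` is
the estimate that the RA has of it. -/
abbrev State : Type := {y : Fin 3 × Fin 3 // y.1 = 2 → y.2 = 2}

/-- The initial state `X(0) = X̂(0) = 0`. -/
def start : State := ⟨(0, 0), by decide⟩

/-- The types of events: an internal event of the machine (arrival of an internal job if `X = 0`,
completion of the current job if `X = 1` or `X = 2`), the arrival of an external job request at the
RA, and the sampling of the machine by the RA. -/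
inductive Event : Type
  | internal
  | request
  | sample

instance : MeasurableSpace Event := ⊤

/-- The machine is free in state `y`. -/
def Free (y : State) : Prop := y.1.1 = 0

/-- In state `y` the RA accepts external job requests, i.e. `X̂ = 0`. -/
def Accepts (y : State) : Prop := y.1.2 = 0

/-- The state after an event. An internal event moves `X` from `0` to `1` and from `1` or `2`
to `0`. A request is rejected without any effect if `X̂ ≠ 0`; if `X̂ = 0` it is accepted and
assigned, so that a free machine starts to process it, a busy machine loses it, and in both cases
the RA learns the state of the machine. Sampling sets `X̂` to `X`. -/
def step (y : State) : Event → State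
  | .internal => ⟨(if y.1.1 = 0 then 1 else 0, y.1.2), by intro h; split at h <;> simp at h⟩
  | .request =>
      if y.1.2 = 0 then
        (if y.1.1 = 0 then ⟨(2, 2), fun _ => rfl⟩ else ⟨(y.1.1, y.1.1), fun h => h⟩)
      else y
  | .sample => ⟨(y.1.1, y.1.1), fun h => h⟩

namespace Rates

variable (r : Rates)

/-- The rate of internal events, as a function of the state `X` of the machine. -/
def internalRate (x : Fin 3) : ℝ := ![r.alpha, r.beta, r.gamma] x

/-- The rate at which events of a given type occur in state `y`. -/
def rate (y : State) : Event → ℝ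
  | .internal => r.internalRate y.1.1
  | .request => r.lam
  | .sample => r.mu

/-- The total rate of events in state `y`, including those that do not change the state. -/
def totalRate (y : State) : ℝ :=
  r.rate y .internal + r.rate y .request + r.rate y .sample

lemma rate_nonneg (y : State) (e : Event) : 0 ≤ r.rate y e := by
  cases e with
  | internal =>
    obtain ⟨⟨x, z⟩, h⟩ := y
    fin_cases x
    · exact r.alpha_pos.le
    · exact r.beta_pos.le
    · exact r.gamma_pos.le
  | request => exact r.lam_pos.le
  | sample => exact r.mu_nonneg

lemma totalRate_pos (y : State) : 0 < r.totalRate y := by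
  have h1 := r.rate_nonneg y .internal
  have h2 := r.lam_pos
  have h3 := r.mu_nonneg
  simp only [totalRate, rate] at *
  linarith

/-- The law of the type of the next event in state `y`: each type has a probability proportional
to its rate. -/
def eventLaw (y : State) : Measure Event :=
  ENNReal.ofReal (r.rate y .internal / r.totalRate y) • Measure.dirac .internal
    + ENNReal.ofReal (r.rate y .request / r.totalRate y) • Measure.dirac .request
    + ENNReal.ofReal (r.rate y .sample / r.totalRate y) • Measure.dirac .sample

instance (y : State) : IsProbabilityMeasure (r.eventLaw y) := by
  constructor
  have h := r.totalRate_pos y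
  have h0 := fun e => div_nonneg (r.rate_nonneg y e) h.le
  simp only [eventLaw, Measure.add_apply, Measure.smul_apply, measure_univ, smul_eq_mul, mul_one]
  rw [← ENNReal.ofReal_add (h0 _) (h0 _), ← ENNReal.ofReal_add (add_nonneg (h0 _) (h0 _)) (h0 _),
    ← add_div, ← add_div]
  have h1 : (r.rate y .internal + r.rate y .request + r.rate y .sample) / r.totalRate y = 1 :=
    div_self h.ne'
  rw [h1, ENNReal.ofReal_one]

instance (y : State) : IsProbabilityMeasure (expMeasure (r.totalRate y)) :=
  isProbabilityMeasure_expMeasure (r.totalRate_pos y)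

end Rates

/-- One period between consecutive events: the state `Y` during the period, the length of the
period, and the type of the event that ends it. -/
abbrev Period : Type := State × ℝ × Event

namespace Period

/-- The state during the period. -/
def state (z : Period) : State := z.1

/-- The length of the period. -/
def hold (z : Period) : ℝ := z.2.1

/-- The type of the event that ends the period. -/
def event (z : Period) : Event := z.2.2

/-- The state in the next period. -/
def next (z : Period) : State := step z.state z.event

end Period

lemma measurable_next : Measurable Period.next := by
  have h : Measurable (fun p : State × Event => step p.1 p.2) :=
    measurable_from_prod_countable_right (fun _ => measurable_from_top)
  exact h.comp (measurable_fst.prodMk (measurable_snd.comp measurable_snd))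

namespace Rates

variable (r : Rates)

/-- The law of a period in state `y`: its length is exponential with the total rate of events in
`y`, and the type of the event that ends it is independent of the length. -/
def periodLaw : Kernel State Period where
  toFun y := (Measure.dirac y).prod ((expMeasure (r.totalRate y)).prod (r.eventLaw y))
  measurable' := Measurable.of_discrete

instance : IsMarkovKernel r.periodLaw :=
  ⟨fun y => inferInstanceAs (IsProbabilityMeasure
    ((Measure.dirac y).prod ((expMeasure (r.totalRate y)).prod (r.eventLaw y))))⟩

/-- The law of the sequence of periods of the continuous-time Markov chain `Y = (X, X̂)` started
in `y`: the first period is in state `y`, and given the past, the next period has the law of a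
period in the state that the last event has led to. -/
def law (y : State) : Measure (ℕ → Period) :=
  Kernel.trajMeasure (X := fun _ => Period) (r.periodLaw y)
    (fun n => r.periodLaw.comap (fun h => (h ⟨n, Finset.mem_Iic.2 le_rfl⟩).next)
      (measurable_next.comp (measurable_pi_apply _)))

end Rates

/-- The time at which period `n` ends, i.e. the time of the event with index `n`. -/
def epoch (ω : ℕ → Period) (n : ℕ) : ℝ := ∑ k ∈ Finset.range (n + 1), (ω k).hold

/-- The number of indices `n` with property `p` whose event occurs by time `t`. (Almost surely the
epochs tend to infinity, so that this is the cardinality of a finite set.) -/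
def count (ω : ℕ → Period) (p : Period → Prop) (t : ℝ) : ℕ :=
  {n : ℕ | epoch ω n ≤ t ∧ p (ω n)}.ncard

/-- The state `Y(t) = (X(t), X̂(t))`. -/
def stateAt (ω : ℕ → Period) (t : ℝ) : State := (ω (count ω (fun _ => True) t)).state

/-- The number of requests that the RA has accepted by time `t`. -/
def numAccepted (ω : ℕ → Period) (t : ℝ) : ℕ :=
  count ω (fun z => z.event = .request ∧ Accepts z.state) t

/-- The number of requests that the RA has accepted by time `t` although the machine was busy. -/
def numFalseAccepted (ω : ℕ → Period) (t : ℝ) : ℕ :=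
  count ω (fun z => z.event = .request ∧ Accepts z.state ∧ ¬ Free z.state) t

/-- The number of requests that the RA has rejected by time `t`. -/
def numRejected (ω : ℕ → Period) (t : ℝ) : ℕ :=
  count ω (fun z => z.event = .request ∧ ¬ Accepts z.state) t

/-- The number of requests that the RA has rejected by time `t` although the machine was free. -/
def numFalseRejected (ω : ℕ → Period) (t : ℝ) : ℕ :=
  count ω (fun z => z.event = .request ∧ ¬ Accepts z.state ∧ Free z.state) t

/-- The upper limit, as `T → ∞`, of the proportion of false acceptances among acceptances. -/
def limsupFA (ω : ℕ → Period) : ℝ :=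
  limsup (fun T : ℝ => (numFalseAccepted ω T : ℝ) / (numAccepted ω T : ℝ)) atTop

/-- The upper limit, as `T → ∞`, of the proportion of false rejections among rejections. -/
def limsupFR (ω : ℕ → Period) : ℝ :=
  limsup (fun T : ℝ => (numFalseRejected ω T : ℝ) / (numRejected ω T : ℝ)) atTop

namespace Rates

variable (r : Rates)

/-- The false acceptance ratio of the system started in `X(0) = X̂(0) = 0`. -/
def FAR : ℝ := ∫ ω, limsupFA ω ∂(r.law start)

/-- The false rejection ratio of the system started in `X(0) = X̂(0) = 0`. -/
def FRR : ℝ := ∫ ω, limsupFR ω ∂(r.law start)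

/-- The chain `Y(t)` is recurrent: from every state `y`, it almost surely is in `y` at arbitrarily
large times. -/
def Recurrent : Prop :=
  ∀ y : State, ∀ᵐ ω ∂(r.law y), ∀ T : ℝ, ∃ t ≥ T, stateAt ω t = y

/-- The constant `κ = λ + α + β`. -/
def kappa : ℝ := r.lam + r.alpha + r.beta

/-- The closed form of the false acceptance ratio at a sampling rate `m > 0`, the other rates being
those of `r`. -/
def closedFAR (m : ℝ) : ℝ := r.alpha / (m + r.kappa)

/-- The constant `β̃` in the closed form of the false rejection ratio. -/
def betaTilde : ℝ :=
  r.lam * r.beta * (r.lam + r.beta)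
    + r.gamma * (r.lam * r.beta + r.lam * r.alpha + r.alpha * r.kappa)

/-- The closed form of the false rejection ratio at a sampling rate `m > 0`, the other rates being
those of `r`. -/
def closedFRR (m : ℝ) : ℝ :=
  r.gamma * r.beta * (m * (r.lam + r.alpha) + r.lam * r.kappa)
    / ((r.alpha * r.gamma + r.lam * r.beta) * m ^ 2 + r.betaTilde * m
      + r.gamma * r.lam * (r.beta + r.alpha) * r.kappa)

end Rates

end MarkovMachine

end

/-!
Without sampling, a request makes the estimate `X̂` nonzero and it stays so forever; hence `Y` never
returns to its initial state once a request has arrived. It also follows that exactly one request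
is ever accepted, and the proportion of false acceptances eventually is the indicator of the event
that this request finds the machine busy. Its probability is the value at the initial state of a
function `h` of the state such that the number of false acceptances plus `h(Y)` is a martingale.
All requests but one are rejected, and the numbers of rejections and false rejections obey a strong
law of large numbers: with a solution of the Poisson equation, the number of false rejections minus
`β / (α + β)` times the number of rejections becomes, up to a bounded error, a sum of bounded
orthogonal increments, whose averages converge to `0` almost surely.
-/

section Average

open Asymptotics

lemma eventually_natCast_succ_sq_le {a : ℝ} (ha : 1 < a) :
    ∀ᶠ n : ℕ in atTop, (((n + 1) ^ 2 : ℕ) : ℝ) ≤ a * (n ^ 2 : ℕ) := by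
  have hlim : Tendsto (fun n : ℕ => (1 + 1 / (n : ℝ)) ^ 2) atTop (𝓝 1) := by
    simpa using (tendsto_one_div_atTop_nhds_zero_nat.const_add (1 : ℝ)).pow 2
  filter_upwards [hlim.eventually_le_const ha, eventually_gt_atTop 0] with n hn hn0
  calc (((n + 1) ^ 2 : ℕ) : ℝ) = (1 + 1 / (n : ℝ)) ^ 2 * n ^ 2 := by push_cast; field_simp
    _ ≤ a * (n ^ 2 : ℕ) := by push_cast; gcongr

lemma tendsto_average_of_tendsto_along_sq {u : ℕ → ℝ} {C l : ℝ} (hu : ∀ n, |u n| ≤ C)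
    (h : Tendsto (fun k : ℕ => (∑ i ∈ Finset.range (k ^ 2), u i) / (k ^ 2 : ℕ)) atTop (𝓝 l)) :
    Tendsto (fun n : ℕ => (∑ i ∈ Finset.range n, u i) / n) atTop (𝓝 l) := by
  -- Shifted by `C`, the terms are nonnegative, so that the partial sums are monotone.
  have shift : ∀ n : ℕ, 0 < n → (∑ i ∈ Finset.range n, (u i + C)) / n
      = (∑ i ∈ Finset.range n, u i) / n + C := fun n hn => by
    rw [Finset.sum_add_distrib, Finset.sum_const, Finset.card_range, nsmul_eq_mul]
    field_simp
  have hmono : Monotone fun n => ∑ i ∈ Finset.range n, (u i + C) :=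
    monotone_nat_of_le_succ fun n => by
      rw [Finset.sum_range_succ]
      linarith [(abs_le.1 (hu n)).1]
  have hsq : Tendsto (fun k : ℕ => k ^ 2) atTop atTop := tendsto_pow_atTop two_ne_zero
  have hsub : Tendsto (fun k : ℕ => (∑ i ∈ Finset.range (k ^ 2), (u i + C)) / (k ^ 2 : ℕ)) atTop
      (𝓝 (l + C)) :=
    (h.add_const C).congr' <| (hsq.eventually_gt_atTop 0).mono fun k hk => (shift _ hk).symm
  have hshift := tendsto_div_of_monotone_of_exists_subseq_tendsto_div _ (l + C) hmono fun a ha =>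
    ⟨fun k => k ^ 2, eventually_natCast_succ_sq_le ha, hsq, hsub⟩
  have hlim := hshift.sub_const C
  rw [add_sub_cancel_right] at hlim
  refine hlim.congr' <| (eventually_gt_atTop 0).mono fun n hn => ?_
  rw [shift n hn, add_sub_cancel_right]

lemma tendsto_div_of_average_sub_mul {a b : ℕ → ℝ} {p : ℝ}
    (hab : Tendsto (fun n : ℕ => (a n - p * b n) / n) atTop (𝓝 0))
    (hb : (fun n : ℕ => (n : ℝ)) =O[atTop] b) :
    Tendsto (fun n => a n / b n) atTop (𝓝 p) := by
  have hn : ∀ᶠ n : ℕ in atTop, (n : ℝ) ≠ 0 :=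
    (eventually_gt_atTop 0).mono fun n hn => Nat.cast_ne_zero.2 hn.ne'
  have hb0 : ∀ᶠ n in atTop, b n ≠ 0 := by
    filter_upwards [hb.eq_zero_imp, hn] with n h hn0 using mt h hn0
  have ho : (fun n => a n - p * b n) =o[atTop] b :=
    ((isLittleO_iff_tendsto' (hn.mono fun n hn0 h0 => absurd h0 hn0)).2 hab).trans_isBigO hb
  have hlim := ho.tendsto_div_nhds_zero.add_const p
  rw [zero_add] at hlim
  refine hlim.congr' (hb0.mono fun n hn0 => ?_)
  field_simp
  ring

end Average

section StrongLaw

variable {Ω : Type*} [MeasurableSpace Ω] {P : Measure Ω}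

lemma ae_tendsto_zero_of_summable_integral_sq {f : ℕ → Ω → ℝ} (hf : ∀ n, MemLp (f n) 2 P)
    (hs : Summable fun n => ∫ ω, f n ω ^ 2 ∂P) :
    ∀ᵐ ω ∂P, Tendsto (fun n => f n ω) atTop (𝓝 0) := by
  have hm : ∀ n, AEMeasurable (fun ω => ENNReal.ofReal (f n ω ^ 2)) P := fun n =>
    (hf n).integrable_sq.aemeasurable.ennreal_ofReal
  have hfin : ∫⁻ ω, ∑' n, ENNReal.ofReal (f n ω ^ 2) ∂P ≠ ⊤ := by
    simp_rw [lintegral_tsum hm, ← ofReal_integral_eq_lintegral_ofReal (hf _).integrable_sq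
      (ae_of_all _ fun _ => sq_nonneg _)]
    exact hs.tsum_ofReal_ne_top
  filter_upwards [ae_lt_top' (AEMeasurable.tsum hm) hfin] with ω hω
  have hsq : Tendsto (fun n => f n ω ^ 2) atTop (𝓝 0) := by
    simpa [Function.comp_def, sq_nonneg] using
      (ENNReal.tendsto_toReal ENNReal.zero_ne_top).comp
        (ENNReal.tendsto_atTop_zero_of_tsum_ne_top hω.ne)
  exact (tendsto_zero_iff_abs_tendsto_zero _).2 <| by
    simpa [Function.comp_def, Real.sqrt_sq_eq_abs] using hsq.sqrt

lemma integral_sum_sq_le_of_orthogonal {D : ℕ → Ω → ℝ} {K : ℝ} (hD : ∀ n, MemLp (D n) 2 P)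
    (hK : ∀ n, ∫ ω, D n ω ^ 2 ∂P ≤ K)
    (horth : Pairwise fun i j => ∫ ω, D i ω * D j ω ∂P = 0) (n : ℕ) :
    ∫ ω, (∑ k ∈ Finset.range n, D k ω) ^ 2 ∂P ≤ n * K := by
  have hinteg : ∀ i j, Integrable (fun ω => D i ω * D j ω) P := fun i j =>
    (hD i).integrable_mul (hD j)
  calc ∫ ω, (∑ k ∈ Finset.range n, D k ω) ^ 2 ∂P
      = ∑ i ∈ Finset.range n, ∑ j ∈ Finset.range n, ∫ ω, D i ω * D j ω ∂P := by
        simp_rw [sq, Finset.sum_mul_sum]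
        rw [integral_finsetSum _ fun i _ => integrable_finsetSum _ fun j _ => hinteg i j]
        exact Finset.sum_congr rfl fun i _ => integral_finsetSum _ fun j _ => hinteg i j
    _ = ∑ i ∈ Finset.range n, ∫ ω, D i ω ^ 2 ∂P := by
        refine Finset.sum_congr rfl fun i hi => ?_
        rw [Finset.sum_eq_single_of_mem i hi fun j _ hj => horth hj.symm]
        simp_rw [sq]
    _ ≤ n * K := by
        simpa using Finset.sum_le_card_nsmul (Finset.range n) _ K fun i _ => hK i

lemma ae_tendsto_average_zero_along_sq_of_orthogonal {D : ℕ → Ω → ℝ} {K : ℝ}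
    (hD : ∀ n, MemLp (D n) 2 P) (hK : ∀ n, ∫ ω, D n ω ^ 2 ∂P ≤ K)
    (horth : Pairwise fun i j => ∫ ω, D i ω * D j ω ∂P = 0) :
    ∀ᵐ ω ∂P, Tendsto (fun k : ℕ => (∑ i ∈ Finset.range (k ^ 2), D i ω) / (k ^ 2 : ℕ)) atTop
      (𝓝 0) := by
  have hmem : ∀ n : ℕ, MemLp (fun ω => (∑ i ∈ Finset.range n, D i ω) / n) 2 P := fun n => by
    simpa only [div_eq_inv_mul] using (memLp_finsetSum _ fun i _ => hD i).const_mul (n : ℝ)⁻¹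
  refine ae_tendsto_zero_of_summable_integral_sq (fun k => hmem (k ^ 2)) ?_
  have hs : Summable fun k : ℕ => K * (1 / (k : ℝ) ^ 2) :=
    (Real.summable_one_div_nat_pow.2 one_lt_two).mul_left K
  refine hs.of_nonneg_of_le (fun k => integral_nonneg fun ω => sq_nonneg _) fun k => ?_
  simp_rw [div_pow]
  rw [integral_div]
  calc (∫ ω, (∑ i ∈ Finset.range (k ^ 2), D i ω) ^ 2 ∂P) / ((k ^ 2 : ℕ) : ℝ) ^ 2
      ≤ (k ^ 2 : ℕ) * K / ((k ^ 2 : ℕ) : ℝ) ^ 2 := by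
        gcongr
        exact integral_sum_sq_le_of_orthogonal hD hK horth _
    _ = K * (1 / (k : ℝ) ^ 2) := by
        push_cast
        rcases eq_or_ne (k : ℝ) 0 with hk | hk
        · simp [hk]
        · field_simp

theorem ae_tendsto_average_zero_of_orthogonal [IsFiniteMeasure P] {D : ℕ → Ω → ℝ} {C : ℝ}
    (hm : ∀ n, AEStronglyMeasurable (D n) P) (hC : ∀ n, ∀ᵐ ω ∂P, |D n ω| ≤ C)
    (horth : Pairwise fun i j => ∫ ω, D i ω * D j ω ∂P = 0) :
    ∀ᵐ ω ∂P, Tendsto (fun n : ℕ => (∑ k ∈ Finset.range n, D k ω) / n) atTop (𝓝 0) := by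
  have hD : ∀ n, MemLp (D n) 2 P := fun n => MemLp.of_bound (hm n) C (hC n)
  have hK : ∀ n, ∫ ω, D n ω ^ 2 ∂P ≤ ∫ _, C ^ 2 ∂P := fun n =>
    integral_mono_ae (hD n).integrable_sq (integrable_const _) <|
      (hC n).mono fun ω hω => sq_le_sq' (abs_le.1 hω).1 (abs_le.1 hω).2
  filter_upwards [ae_tendsto_average_zero_along_sq_of_orthogonal hD hK horth, ae_all_iff.2 hC]
    with ω hsq hbound using tendsto_average_of_tendsto_along_sq hbound hsq

end StrongLaw

lemma integral_pos_of_ae_pos {α : Type*} [MeasurableSpace α] {μ : Measure α} [NeZero μ] {f : α → ℝ}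
    (hf : Integrable f μ) (hpos : ∀ᵐ x ∂μ, 0 < f x) : 0 < ∫ x, f x ∂μ := by
  have hnonneg : 0 ≤ᵐ[μ] f := hpos.mono fun x hx => hx.le
  refine (integral_nonneg_of_ae hnonneg).lt_of_ne' fun h0 => ?_
  obtain ⟨x, hx0, hx⟩ := (((integral_eq_zero_iff_of_nonneg_ae hnonneg hf).1 h0).and hpos).exists
  exact hx.ne' hx0

lemma exists_forall_abs_le {ι : Type*} [Finite ι] (f : ι → ℝ) : ∃ C, ∀ i, |f i| ≤ C := by
  obtain ⟨C, hC⟩ := (Set.finite_range fun i => |f i|).bddAbove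
  exact ⟨C, fun i => hC ⟨i, rfl⟩⟩

lemma expMeasure_ae_pos (c : ℝ) : ∀ᵐ x ∂expMeasure c, 0 < x := by
  have h : expMeasure c (Set.Iic 0) = 0 := by
    rw [expMeasure, gammaMeasure, withDensity_apply _ measurableSet_Iic,
      setLIntegral_congr (Iio_ae_eq_Iic (μ := volume)).symm]
    exact lintegral_gammaPDF_of_nonpos le_rfl
  simpa [ae_iff, Set.Iic] using h

noncomputable section

namespace MarkovMachine

instance : DiscreteMeasurableSpace Event := ⟨fun _ => trivial⟩

instance : Finite Event :=
  Set.finite_univ_iff.1 <| (Set.toFinite {.internal, .request, .sample}).subset fun e _ => by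
    cases e <;> simp

namespace Period

lemma measurable_state : Measurable state := measurable_fst

lemma measurable_hold : Measurable hold := measurable_fst.comp measurable_snd

lemma measurable_event : Measurable event := measurable_snd.comp measurable_snd

lemma measurable_comp_state_event {β : Type*} [MeasurableSpace β] (g : State → Event → β) :
    Measurable fun z : Period => g z.state z.event :=
  (Measurable.of_discrete (f := fun p : State × Event => g p.1 p.2)).comp
    (measurable_state.prodMk measurable_event)

end Period

namespace Rates

variable (r : Rates)

section PeriodLaw

lemma integral_eventLaw (y : State) (f : Event → ℝ) : ∫ e, f e ∂r.eventLaw y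
    = (r.rate y .internal * f .internal + r.rate y .request * f .request
      + r.rate y .sample * f .sample) / r.totalRate y := by
  have hnonneg := fun e => div_nonneg (r.rate_nonneg y e) (r.totalRate_pos y).le
  have hinteg : ∀ (μ : Measure Event) [IsFiniteMeasure μ] (c : ℝ),
      Integrable f (ENNReal.ofReal c • μ) := fun μ _ c =>
    Integrable.of_finite.smul_measure ENNReal.ofReal_ne_top
  rw [eventLaw, integral_add_measure ((hinteg _ _).add_measure (hinteg _ _)) (hinteg _ _),
    integral_add_measure (hinteg _ _) (hinteg _ _)]
  simp only [integral_smul_measure, integral_dirac, ENNReal.toReal_ofReal (hnonneg _), smul_eq_mul]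
  ring

lemma ae_periodLaw_state_eq (y : State) : ∀ᵐ z ∂r.periodLaw y, z.state = y :=
  have h : ∀ᵐ x ∂Measure.dirac y, x = y := by simp [ae_dirac_eq]
  Measure.quasiMeasurePreserving_fst.ae h

lemma ae_periodLaw_hold_pos (y : State) : ∀ᵐ z ∂r.periodLaw y, 0 < z.hold :=
  (Measure.quasiMeasurePreserving_fst.comp Measure.quasiMeasurePreserving_snd).ae
    (expMeasure_ae_pos _)

lemma ae_periodLaw_event_ne_sample (hr : r.mu = 0) (y : State) :
    ∀ᵐ z ∂r.periodLaw y, z.event ≠ .sample :=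
  have h : ∀ᵐ e ∂r.eventLaw y, e ≠ .sample := by simp [ae_iff, eventLaw, rate, hr]
  (Measure.quasiMeasurePreserving_snd.comp Measure.quasiMeasurePreserving_snd).ae h

lemma integral_periodLaw (y : State) (g : State → Event → ℝ) :
    ∫ z, g z.state z.event ∂r.periodLaw y = ∫ e, g y e ∂r.eventLaw y := by
  have hg : AEStronglyMeasurable (g y) ((r.periodLaw y).map Period.event) :=
    Measurable.of_discrete.aestronglyMeasurable
  have hmap : (r.periodLaw y).map Period.event = r.eventLaw y := by
    change ((Measure.dirac y).prod ((expMeasure (r.totalRate y)).prod (r.eventLaw y))).map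
      (Prod.snd ∘ Prod.snd) = _
    rw [← Measure.map_map measurable_snd measurable_snd, Measure.map_snd_prod,
      measure_univ, one_smul, Measure.map_snd_prod, measure_univ, one_smul]
  calc ∫ z, g z.state z.event ∂r.periodLaw y = ∫ z, g y z.event ∂r.periodLaw y :=
        integral_congr_ae <| (r.ae_periodLaw_state_eq y).mono fun z hz => by simp only [hz]
    _ = ∫ e, g y e ∂r.eventLaw y := by
        rw [← hmap, integral_map Period.measurable_event.aemeasurable hg]

end PeriodLaw

section Law

instance (y : State) : IsProbabilityMeasure (r.law y) :=
  inferInstanceAs (IsProbabilityMeasure (Kernel.trajMeasure _ _))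

lemma map_law_zero (y : State) : (r.law y).map (fun ω => ω 0) = r.periodLaw y := by
  have h : (fun ω : ℕ → Period => ω 0)
      = (fun x : (Π _ : Finset.Iic 0, Period) => x ⟨0, by simp⟩) ∘ Preorder.frestrictLe 0 := rfl
  rw [h, ← Measure.map_map (by fun_prop) (by fun_prop), law, Kernel.trajMeasure,
    Measure.map_comp _ _ (by fun_prop), Kernel.traj_map_frestrictLe, Kernel.partialTraj_self,
    Measure.id_comp, Measure.map_map (by fun_prop) (by fun_prop)]
  exact Measure.map_id

lemma map_law_succ (y : State) (n : ℕ) :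
    (r.law y).map (fun ω => (Preorder.frestrictLe (π := fun _ => Period) n ω, ω (n + 1)))
      = (r.law y).map (Preorder.frestrictLe (π := fun _ => Period) n)
        ⊗ₘ r.periodLaw.comap (fun h => (h ⟨n, Finset.mem_Iic.2 le_rfl⟩).next)
          (measurable_next.comp (measurable_pi_apply _)) :=
  Kernel.map_frestrictLe_trajMeasure_compProd_eq_map_trajMeasure.symm

lemma ae_law_of_forall_periodLaw (y : State) {p : State → Period → Prop}
    (hp : MeasurableSet {x : State × Period | p x.1 x.2})
    (h : ∀ y', ∀ᵐ z ∂r.periodLaw y', p y' z) :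
    ∀ᵐ ω ∂r.law y, p y (ω 0) ∧ ∀ n, p (ω n).next (ω (n + 1)) := by
  have h0 : ∀ᵐ ω ∂r.law y, p y (ω 0) :=
    ae_of_ae_map (measurable_pi_apply 0).aemeasurable (by rw [map_law_zero]; exact h y)
  have hsucc : ∀ n, ∀ᵐ ω ∂r.law y, p (ω n).next (ω (n + 1)) := fun n => by
    have hnext : Measurable fun x : Π _ : Finset.Iic n, Period =>
        (x ⟨n, Finset.mem_Iic.2 le_rfl⟩).next := measurable_next.comp (measurable_pi_apply _)
    have h' : ∀ᵐ x ∂(r.law y).map (fun ω => (Preorder.frestrictLe (π := fun _ => Period) n ω,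
        ω (n + 1))), p (x.1 ⟨n, Finset.mem_Iic.2 le_rfl⟩).next x.2 := by
      rw [map_law_succ]
      exact (Measure.ae_compProd_iff
        (hp.preimage ((hnext.comp measurable_fst).prodMk measurable_snd))).2
        (ae_of_all _ fun x => h _)
    exact ae_of_ae_map (by fun_prop) h'
  exact h0.and (ae_all_iff.2 hsucc)

lemma integral_law_zero (y : State) {f : Period → ℝ} (hf : Measurable f) :
    ∫ ω, f (ω 0) ∂r.law y = ∫ z, f z ∂r.periodLaw y := by
  rw [← map_law_zero, integral_map (measurable_pi_apply 0).aemeasurable hf.aestronglyMeasurable]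

lemma integral_law_succ (y : State) (n : ℕ) {F : (Π _ : Finset.Iic n, Period) × Period → ℝ}
    (hF : Measurable F)
    (hinteg : Integrable (fun ω => F (Preorder.frestrictLe n ω, ω (n + 1))) (r.law y)) :
    ∫ ω, F (Preorder.frestrictLe n ω, ω (n + 1)) ∂r.law y
      = ∫ ω, ∫ z, F (Preorder.frestrictLe n ω, z) ∂r.periodLaw (ω n).next ∂r.law y := by
  have hpair : Measurable fun ω : ℕ → Period =>
    (Preorder.frestrictLe (π := fun _ => Period) n ω, ω (n + 1)) := by fun_prop
  have hpast : Measurable (Preorder.frestrictLe (π := fun _ => Period) n) := by fun_prop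
  have hF' := hF.aestronglyMeasurable (μ := (r.law y).map fun ω =>
    (Preorder.frestrictLe (π := fun _ => Period) n ω, ω (n + 1)))
  have hinteg' := (integrable_map_measure hF' hpair.aemeasurable).2 hinteg
  have : IsProbabilityMeasure ((r.law y).map (Preorder.frestrictLe (π := fun _ => Period) n)) :=
    Measure.isProbabilityMeasure_map hpast.aemeasurable
  rw [← integral_map hpair.aemeasurable hF']
  rw [map_law_succ] at hinteg' ⊢
  rw [Measure.integral_compProd hinteg', integral_map hpast.aemeasurable
    hF.stronglyMeasurable.integral_kernel_prod_right'.aestronglyMeasurable]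
  rfl

end Law

section LawOfLargeNumbers

lemma integral_law_eq_of_forall_periodLaw (y : State) {f : Period → ℝ} {C c : ℝ}
    (hf : Measurable f) (hC : ∀ z, |f z| ≤ C) (hc : ∀ y', ∫ z, f z ∂r.periodLaw y' = c) (n : ℕ) :
    ∫ ω, f (ω n) ∂r.law y = c := by
  cases n with
  | zero => rw [integral_law_zero r y hf, hc]
  | succ n =>
    have hinteg : Integrable (fun ω : ℕ → Period => f (ω (n + 1))) (r.law y) :=
      Integrable.of_bound (hf.comp (measurable_pi_apply _)).aestronglyMeasurable C
        (ae_of_all _ fun ω => hC _)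
    rw [r.integral_law_succ y n (F := fun x => f x.2) (hf.comp measurable_snd) hinteg]
    simp [hc]

lemma integral_law_mul_eq_zero (y : State) {f : Period → ℝ} {C : ℝ} (hf : Measurable f)
    (hC : ∀ z, |f z| ≤ C) (h0 : ∀ y', ∫ z, f z ∂r.periodLaw y' = 0) {i j : ℕ} (hij : i < j) :
    ∫ ω, f (ω i) * f (ω j) ∂r.law y = 0 := by
  obtain ⟨n, rfl⟩ := Nat.exists_eq_succ_of_ne_zero (Nat.ne_zero_of_lt hij)
  have hi : i ∈ Finset.Iic n := Finset.mem_Iic.2 (Nat.le_of_lt_succ hij)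
  have hF : Measurable fun x : (Π _ : Finset.Iic n, Period) × Period => f (x.1 ⟨i, hi⟩) * f x.2 :=
    (hf.comp ((measurable_pi_apply _).comp measurable_fst)).mul (hf.comp measurable_snd)
  have hbound : ∀ ω : ℕ → Period, ‖f (ω i) * f (ω (n + 1))‖ ≤ C * C := fun ω => by
    rw [Real.norm_eq_abs, abs_mul]
    exact mul_le_mul (hC _) (hC _) (abs_nonneg _) ((abs_nonneg _).trans (hC (ω i)))
  have hinteg : Integrable (fun ω : ℕ → Period => f (ω i) * f (ω (n + 1))) (r.law y) :=
    Integrable.of_bound ((hf.comp (measurable_pi_apply _)).mul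
      (hf.comp (measurable_pi_apply _))).aestronglyMeasurable _ (ae_of_all _ hbound)
  refine (r.integral_law_succ y n hF hinteg).trans ?_
  simp [integral_const_mul, h0]

theorem ae_tendsto_average_sub_integral (y : State) {f : Period → ℝ} {C : ℝ} (hf : Measurable f)
    (hC : ∀ z, |f z| ≤ C) :
    ∀ᵐ ω ∂r.law y, Tendsto (fun n : ℕ =>
      (∑ k ∈ Finset.range n, (f (ω k) - ∫ z, f z ∂r.periodLaw (ω k).state)) / n) atTop (𝓝 0) := by
  set m : State → ℝ := fun y' => ∫ z, f z ∂r.periodLaw y' with hm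
  have hcm : Measurable fun z : Period => f z - m z.state :=
    hf.sub (Period.measurable_comp_state_event fun y' _ => m y')
  have hmC : ∀ y', |m y'| ≤ C := fun y' => by
    simpa using norm_integral_le_of_norm_le_const (μ := r.periodLaw y') (f := f) (ae_of_all _ hC)
  have hcC : ∀ z : Period, |f z - m z.state| ≤ C + C := fun z =>
    (abs_sub _ _).trans (add_le_add (hC z) (hmC _))
  have hc0 : ∀ y', ∫ z, (f z - m z.state) ∂r.periodLaw y' = 0 := fun y' => by
    have hae : (fun z : Period => f z - m z.state) =ᵐ[r.periodLaw y'] fun z => f z - m y' :=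
      (r.ae_periodLaw_state_eq y').mono fun z hz => by simp only [hz]
    rw [integral_congr_ae hae, integral_sub
      (Integrable.of_bound hf.aestronglyMeasurable C (ae_of_all _ hC)) (integrable_const _)]
    simp [hm]
  refine ae_tendsto_average_zero_of_orthogonal (C := C + C)
    (fun n => (hcm.comp (measurable_pi_apply n)).aestronglyMeasurable)
    (fun n => ae_of_all _ fun ω => hcC _) fun i j hij => ?_
  rcases hij.lt_or_gt with h | h
  · exact r.integral_law_mul_eq_zero y hcm hcC hc0 h
  · refine (integral_congr_ae (ae_of_all _ fun ω => mul_comm _ _)).trans ?_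
    exact r.integral_law_mul_eq_zero y hcm hcC hc0 h

lemma ae_exists_eventually_mul_le_sum (y : State) {f : Period → ℝ} {C : ℝ} (hf : Measurable f)
    (hC : ∀ z, |f z| ≤ C) (hpos : ∀ y', 0 < ∫ z, f z ∂r.periodLaw y') :
    ∀ᵐ ω ∂r.law y, ∃ c > 0, ∀ᶠ n : ℕ in atTop, c * n ≤ ∑ k ∈ Finset.range n, f (ω k) := by
  have : Nonempty State := ⟨y⟩
  obtain ⟨y₀, hy₀⟩ := Finite.exists_min fun y' => ∫ z, f z ∂r.periodLaw y'
  set c := ∫ z, f z ∂r.periodLaw y₀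
  have hc0 : 0 < c := hpos y₀
  filter_upwards [r.ae_tendsto_average_sub_integral y hf hC] with ω hω
  refine ⟨c / 2, half_pos hc0, ?_⟩
  filter_upwards [hω.eventually (lt_mem_nhds (by linarith : -(c / 2) < 0)),
    eventually_gt_atTop 0] with n hn hn0
  rw [lt_div_iff₀ (Nat.cast_pos.2 hn0), Finset.sum_sub_distrib] at hn
  have hmean : n * c ≤ ∑ k ∈ Finset.range n, ∫ z, f z ∂r.periodLaw (ω k).state := by
    simpa using Finset.card_nsmul_le_sum (Finset.range n) _ c fun k _ => hy₀ (ω k).state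
  linarith

end LawOfLargeNumbers

end Rates

section Trajectory

/-- A sequence of periods that the chain can run through when it starts in `y`: every period is in
the state that the event ending the previous one has led to, and has a positive length. -/
structure IsTrajectory (y : State) (ω : ℕ → Period) : Prop where
  state_zero : (ω 0).state = y
  state_succ : ∀ n, (ω (n + 1)).state = (ω n).next
  hold_pos : ∀ n, 0 < (ω n).hold

lemma Rates.ae_isTrajectory (r : Rates) (y : State) : ∀ᵐ ω ∂r.law y, IsTrajectory y ω := by
  have hp : MeasurableSet {x : State × Period | x.2.state = x.1 ∧ 0 < x.2.hold} :=
    (measurableSet_eq_fun (Period.measurable_state.comp measurable_snd) measurable_fst).inter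
      (measurableSet_lt measurable_const (Period.measurable_hold.comp measurable_snd))
  have h := r.ae_law_of_forall_periodLaw y hp fun y' =>
    (r.ae_periodLaw_state_eq y').and (r.ae_periodLaw_hold_pos y')
  filter_upwards [h] with ω ⟨h0, hsucc⟩
  refine ⟨h0.1, fun n => (hsucc n).1, fun n => ?_⟩
  cases n with
  | zero => exact h0.2
  | succ n => exact (hsucc n).2

lemma Rates.ae_event_ne_sample (r : Rates) (hr : r.mu = 0) (y : State) :
    ∀ᵐ ω ∂r.law y, ∀ n, (ω n).event ≠ .sample := by
  have hp : MeasurableSet {x : State × Period | x.2.event ≠ .sample} :=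
    (measurableSet_eq_fun (Period.measurable_event.comp measurable_snd) measurable_const).compl
  filter_upwards [r.ae_law_of_forall_periodLaw y hp fun y' => r.ae_periodLaw_event_ne_sample hr y']
    with ω ⟨h0, hsucc⟩ n
  cases n with
  | zero => exact h0
  | succ n => exact hsucc n

lemma Rates.ae_tendsto_epoch (r : Rates) (y : State) :
    ∀ᵐ ω ∂r.law y, Tendsto (epoch ω) atTop atTop := by
  have hm : Measurable fun z : Period => min |z.hold| 1 :=
    (measurable_norm.comp Period.measurable_hold).min measurable_const
  have hbound : ∀ z : Period, |min |z.hold| 1| ≤ 1 := fun z => by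
    rw [abs_of_nonneg (le_min (abs_nonneg _) zero_le_one)]
    exact min_le_right _ _
  have hpos : ∀ y', 0 < ∫ z, min |z.hold| 1 ∂r.periodLaw y' := fun y' =>
    integral_pos_of_ae_pos (Integrable.of_bound hm.aestronglyMeasurable 1 (ae_of_all _ hbound)) <|
      (r.ae_periodLaw_hold_pos y').mono fun z hz => lt_min (abs_pos.2 hz.ne') one_pos
  filter_upwards [r.ae_exists_eventually_mul_le_sum y hm hbound hpos, r.ae_isTrajectory y]
    with ω ⟨c, hc, hsum⟩ hω
  have hlin : Tendsto (fun n : ℕ => c * n) atTop atTop :=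
    tendsto_natCast_atTop_atTop.const_mul_atTop hc
  refine tendsto_atTop_mono' _ (hsum.mono fun n hn => hn.trans ?_) hlin
  rw [epoch, Finset.sum_range_succ]
  refine le_add_of_le_of_nonneg (Finset.sum_le_sum fun k _ => ?_) (hω.hold_pos n).le
  exact (min_le_left _ _).trans (abs_of_pos (hω.hold_pos k)).le

end Trajectory

section Poisson

variable {r : Rates} {g : State → Event → ℝ} {h : State → ℝ} {c : ℝ}

/-- The Poisson equation with rewards `g`, potential `h` and mean reward `c`: in every state, the
expected reward earned at the next event and the expected increment of the potential there add up
to `c`. -/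
def Rates.SolvesPoisson (r : Rates) (g : State → Event → ℝ) (h : State → ℝ) (c : ℝ) : Prop :=
  ∀ y, ∫ e, (g y e + h (step y e) - h y) ∂r.eventLaw y = c

lemma IsTrajectory.sum_add_potential_sub {y : State} {ω : ℕ → Period} (hω : IsTrajectory y ω)
    (g : State → Event → ℝ) (h : State → ℝ) (n : ℕ) :
    ∑ k ∈ Finset.range n,
        (g (ω k).state (ω k).event + h (step (ω k).state (ω k).event) - h (ω k).state)
      = ∑ k ∈ Finset.range n, g (ω k).state (ω k).event + h (ω n).state - h y := by
  have hstep : ∀ k, step (ω k).state (ω k).event = (ω (k + 1)).state := fun k =>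
    (hω.state_succ k).symm
  simp only [hstep, add_sub_assoc, Finset.sum_add_distrib,
    Finset.sum_range_sub fun k => h (ω k).state, hω.state_zero]

theorem Rates.SolvesPoisson.ae_tendsto_average (hP : r.SolvesPoisson g h c) (y : State) :
    ∀ᵐ ω ∂r.law y, Tendsto (fun n : ℕ =>
      (∑ k ∈ Finset.range n, g (ω k).state (ω k).event) / n) atTop (𝓝 c) := by
  set d : State → Event → ℝ := fun y e => g y e + h (step y e) - h y
  obtain ⟨B, hB⟩ := exists_forall_abs_le h
  obtain ⟨C, hC⟩ := exists_forall_abs_le fun p : State × Event => d p.1 p.2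
  have hmean : ∀ y', ∫ z, d z.state z.event ∂r.periodLaw y' = c := fun y' =>
    (r.integral_periodLaw y' d).trans (hP y')
  have hmart := r.ae_tendsto_average_sub_integral y (Period.measurable_comp_state_event d)
    fun z => hC (z.state, z.event)
  simp only [hmean, Finset.sum_sub_distrib] at hmart
  filter_upwards [r.ae_isTrajectory y, hmart] with ω hω hlim
  have hpot : Tendsto (fun n : ℕ => (h (ω n).state - h y) / n) atTop (𝓝 0) := by
    have hbound : ∀ n, |h (ω n).state - h y| ≤ B + B := fun n =>
      (abs_sub _ _).trans (add_le_add (hB _) (hB _))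
    exact tendsto_bdd_div_atTop_nhds_zero (.of_forall fun n => (abs_le.1 (hbound n)).1)
      (.of_forall fun n => (abs_le.1 (hbound n)).2) tendsto_natCast_atTop_atTop
  have hlim' := (hlim.sub hpot).add_const c
  rw [sub_zero, zero_add] at hlim'
  refine hlim'.congr' ((eventually_ne_atTop 0).mono fun n hn => ?_)
  have hn' : (n : ℝ) ≠ 0 := Nat.cast_ne_zero.2 hn
  simp only [d, hω.sum_add_potential_sub, Finset.sum_const, Finset.card_range, nsmul_eq_mul]
  field_simp
  ring

lemma Rates.SolvesPoisson.integral_sum_add_potential (hP : r.SolvesPoisson g h c) (y : State)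
    (n : ℕ) :
    ∫ ω, (∑ k ∈ Finset.range n, g (ω k).state (ω k).event + h (ω n).state) ∂r.law y
      = h y + n * c := by
  set d : State → Event → ℝ := fun y e => g y e + h (step y e) - h y
  have hd : Measurable fun z : Period => d z.state z.event := Period.measurable_comp_state_event d
  obtain ⟨C, hC⟩ := exists_forall_abs_le fun p : State × Event => d p.1 p.2
  have hinteg : ∀ k, Integrable (fun ω : ℕ → Period => d (ω k).state (ω k).event) (r.law y) :=
    fun k => Integrable.of_bound (hd.comp (measurable_pi_apply k)).aestronglyMeasurable C
      (ae_of_all _ fun ω => hC ((ω k).state, (ω k).event))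
  have hmean : ∀ k, ∫ ω, d (ω k).state (ω k).event ∂r.law y = c :=
    r.integral_law_eq_of_forall_periodLaw y hd (fun z => hC (z.state, z.event)) fun y' =>
      (r.integral_periodLaw y' d).trans (hP y')
  have hsum : (fun ω => ∑ k ∈ Finset.range n, g (ω k).state (ω k).event + h (ω n).state)
      =ᵐ[r.law y] fun ω => h y + ∑ k ∈ Finset.range n, d (ω k).state (ω k).event :=
    (r.ae_isTrajectory y).mono fun ω hω => by
      simp only [d, hω.sum_add_potential_sub, add_sub_cancel]
  rw [integral_congr_ae hsum, integral_add (integrable_const _)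
    (integrable_finsetSum _ fun k _ => hinteg k), integral_finsetSum _ fun k _ => hinteg k]
  simp [hmean]

lemma Rates.SolvesPoisson.integrable_and_integral_eq_of_tendsto (hP : r.SolvesPoisson g h 0)
    {y : State} {L : (ℕ → Period) → ℝ} {C : ℝ}
    (hC : ∀ᵐ ω ∂r.law y, ∀ n, |∑ k ∈ Finset.range n, g (ω k).state (ω k).event| ≤ C)
    (hL : ∀ᵐ ω ∂r.law y, Tendsto (fun n =>
      ∑ k ∈ Finset.range n, g (ω k).state (ω k).event + h (ω n).state) atTop (𝓝 (L ω))) :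
    Integrable L (r.law y) ∧ ∫ ω, L ω ∂r.law y = h y := by
  obtain ⟨B, hB⟩ := exists_forall_abs_le h
  set W : ℕ → (ℕ → Period) → ℝ := fun n ω =>
    ∑ k ∈ Finset.range n, g (ω k).state (ω k).event + h (ω n).state with hW
  have hmeas : ∀ n, AEStronglyMeasurable (W n) (r.law y) := fun n =>
    ((Finset.measurable_sum _ fun k _ => (Period.measurable_comp_state_event g).comp
      (measurable_pi_apply k)).add ((Period.measurable_comp_state_event fun y' _ => h y').comp
        (measurable_pi_apply n))).aestronglyMeasurable
  have hbound : ∀ᵐ ω ∂r.law y, ∀ n, ‖W n ω‖ ≤ C + B := hC.mono fun ω hω n =>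
    (abs_add_le _ _).trans (add_le_add (hω n) (hB _))
  refine ⟨Integrable.of_bound (aestronglyMeasurable_of_tendsto_ae _ hmeas hL) (C + B) ?_, ?_⟩
  · filter_upwards [hbound, hL] with ω hω hlim
    exact le_of_tendsto hlim.norm (.of_forall hω)
  · refine tendsto_nhds_unique (tendsto_integral_of_dominated_convergence (fun _ => C + B) hmeas
      (integrable_const _) (fun n => hbound.mono fun ω hω => hω n) hL) ?_
    simp only [hW, hP.integral_sum_add_potential, mul_zero, add_zero, tendsto_const_nhds]

end Poisson

section Tally

/-- An external job request arrives. -/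
def IsRequest (_ : State) (e : Event) : Prop := e = .request

/-- A request is accepted. -/
def IsAcceptance (y : State) (e : Event) : Prop := e = .request ∧ Accepts y

/-- A request is accepted although the machine is busy. -/
def IsFalseAcceptance (y : State) (e : Event) : Prop := e = .request ∧ Accepts y ∧ ¬ Free y

/-- A request is rejected. -/
def IsRejection (y : State) (e : Event) : Prop := e = .request ∧ ¬ Accepts y

/-- A request is rejected although the machine is free. -/
def IsFalseRejection (y : State) (e : Event) : Prop := e = .request ∧ ¬ Accepts y ∧ Free y

open Classical in
/-- The reward that makes accumulated rewards count the events with property `P`. -/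
def unitReward (P : State → Event → Prop) (y : State) (e : Event) : ℝ := if P y e then 1 else 0

open Classical in
/-- The number of events with property `P` among the first `n` events. In contrast to `count`,
this is a discrete-time count. -/
def tally (P : State → Event → Prop) (ω : ℕ → Period) (n : ℕ) : ℕ :=
  Nat.count (fun k => P (ω k).state (ω k).event) n

variable {P Q : State → Event → Prop} {ω : ℕ → Period} {n : ℕ}

lemma tally_succ_of_pos (h : P (ω n).state (ω n).event) : tally P ω (n + 1) = tally P ω n + 1 := by
  classical exact Nat.count_succ_eq_succ_count h

lemma tally_succ_of_neg (h : ¬ P (ω n).state (ω n).event) : tally P ω (n + 1) = tally P ω n := by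
  classical exact Nat.count_succ_eq_count h

lemma tally_monotone (P : State → Event → Prop) (ω : ℕ → Period) : Monotone (tally P ω) := by
  classical exact Nat.count_monotone _

lemma tally_mono (h : ∀ y e, P y e → Q y e) : tally P ω n ≤ tally Q ω n := by
  classical exact Nat.count_mono_left (p := fun k => P (ω k).state (ω k).event) fun _ _ => h _ _

lemma tally_isRequest_eq_add (ω : ℕ → Period) (n : ℕ) :
    tally IsRequest ω n = tally IsAcceptance ω n + tally IsRejection ω n := by
  classical
  have hsplit := Finset.card_filter_add_card_filter_not
    (s := {k ∈ Finset.range n | (ω k).event = .request}) fun k => Accepts (ω k).state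
  rw [Finset.filter_filter, Finset.filter_filter] at hsplit
  simp only [tally, Nat.count_eq_card_filter_range]
  exact hsplit.symm.trans (by congr)

lemma sum_unitReward (P : State → Event → Prop) (ω : ℕ → Period) (n : ℕ) :
    ∑ k ∈ Finset.range n, unitReward P (ω k).state (ω k).event = tally P ω n := by
  classical
  simp only [unitReward, Finset.sum_boole, tally, Nat.count_eq_card_filter_range]

end Tally

section Clock

/-- The number of events by time `t`, i.e. the index of the period that contains `t`. -/
def numEvents (ω : ℕ → Period) (t : ℝ) : ℕ := count ω (fun _ => True) t

variable {y : State} {ω : ℕ → Period}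

lemma IsTrajectory.strictMono_epoch (hω : IsTrajectory y ω) : StrictMono (epoch ω) :=
  strictMono_nat_of_lt_succ fun n => by
    rw [epoch, epoch, Finset.sum_range_succ _ (n + 1)]
    exact lt_add_of_pos_right _ (hω.hold_pos _)

lemma IsTrajectory.epoch_le_iff (hω : IsTrajectory y ω) (hlim : Tendsto (epoch ω) atTop atTop)
    {n : ℕ} {t : ℝ} : epoch ω n ≤ t ↔ n < numEvents ω t := by
  have hex : ∃ N, t < epoch ω N := (hlim.eventually_gt_atTop t).exists
  have hfind : ∀ n, epoch ω n ≤ t ↔ n < Nat.find hex := fun n => by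
    rw [Nat.lt_find_iff]
    exact ⟨fun h m hm => not_lt.2 ((hω.strictMono_epoch.monotone hm).trans h),
      fun h => not_lt.1 (h n le_rfl)⟩
  have hset : {n | epoch ω n ≤ t ∧ True} = Set.Iio (Nat.find hex) := by
    ext n
    simp only [and_true, Set.mem_ofPred_eq, hfind, Set.mem_Iio]
  rw [numEvents, count, hset, ← Finset.coe_Iio, Set.ncard_coe_finset, Nat.card_Iio, hfind]

lemma IsTrajectory.tendsto_numEvents (hω : IsTrajectory y ω)
    (hlim : Tendsto (epoch ω) atTop atTop) : Tendsto (numEvents ω) atTop atTop :=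
  tendsto_atTop.2 fun n => (eventually_ge_atTop (epoch ω n)).mono fun _ ht =>
    ((hω.epoch_le_iff hlim).1 ht).le

lemma IsTrajectory.count_eq_tally (hω : IsTrajectory y ω) (hlim : Tendsto (epoch ω) atTop atTop)
    (P : State → Event → Prop) (t : ℝ) :
    count ω (fun z => P z.state z.event) t = tally P ω (numEvents ω t) := by
  classical
  have hset : {n | epoch ω n ≤ t ∧ P (ω n).state (ω n).event}
      = ((Finset.range (numEvents ω t)).filter fun n => P (ω n).state (ω n).event : Finset ℕ) := by
    ext n
    simp [hω.epoch_le_iff hlim]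
  rw [count, hset, Set.ncard_coe_finset, tally, Nat.count_eq_card_filter_range]

lemma IsTrajectory.limsup_count_div_count (hω : IsTrajectory y ω)
    (hlim : Tendsto (epoch ω) atTop atTop) {P Q : State → Event → Prop} {L : ℝ}
    (hL : Tendsto (fun n => (tally P ω n / tally Q ω n : ℝ)) atTop (𝓝 L)) :
    limsup (fun t : ℝ => (count ω (fun z => P z.state z.event) t
      / count ω (fun z => Q z.state z.event) t : ℝ)) atTop = L := by
  simp only [hω.count_eq_tally hlim]
  exact (hL.comp (hω.tendsto_numEvents hlim)).limsup_eq

end Clock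

section SingleAcceptance

variable {y : State} {ω : ℕ → Period}

lemma accepts_step_iff {e : Event} (he : e ≠ .sample) :
    Accepts (step y e) ↔ Accepts y ∧ e ≠ .request := by
  obtain ⟨⟨x, z⟩, hy⟩ := y
  cases e <;> fin_cases x <;> fin_cases z <;> simp [Accepts, step] at he hy ⊢

lemma IsTrajectory.accepts_state_iff (hω : IsTrajectory y ω) (hy : Accepts y)
    (hs : ∀ n, (ω n).event ≠ .sample) (n : ℕ) :
    Accepts (ω n).state ↔ tally IsRequest ω n = 0 := by
  induction n with
  | zero => simpa [tally, hω.state_zero] using hy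
  | succ n ih =>
    rw [hω.state_succ, Period.next, accepts_step_iff (hs n), ih]
    by_cases h : IsRequest (ω n).state (ω n).event
    · simp [tally_succ_of_pos h, show (ω n).event = .request from h]
    · simp [tally_succ_of_neg h, show (ω n).event ≠ .request from h]

lemma IsTrajectory.tally_isAcceptance_eq_min (hω : IsTrajectory y ω) (hy : Accepts y)
    (hs : ∀ n, (ω n).event ≠ .sample) (n : ℕ) :
    tally IsAcceptance ω n = min (tally IsRequest ω n) 1 := by
  induction n with
  | zero => simp [tally]
  | succ n ih =>
    have hacc : IsAcceptance (ω n).state (ω n).event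
        ↔ IsRequest (ω n).state (ω n).event ∧ tally IsRequest ω n = 0 :=
      and_congr_right fun _ => hω.accepts_state_iff hy hs n
    by_cases hreq : IsRequest (ω n).state (ω n).event
    · by_cases h0 : tally IsRequest ω n = 0
      · rw [tally_succ_of_pos (hacc.2 ⟨hreq, h0⟩), tally_succ_of_pos hreq, ih, h0]
        rfl
      · rw [tally_succ_of_neg fun h => h0 (hacc.1 h).2, tally_succ_of_pos hreq, ih]
        omega
    · rw [tally_succ_of_neg fun h => hreq (hacc.1 h).1, tally_succ_of_neg hreq, ih]

lemma Rates.ae_exists_eventually_mul_le_tally_isRequest (r : Rates) (y : State) :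
    ∀ᵐ ω ∂r.law y, ∃ c > (0 : ℝ), ∀ᶠ n : ℕ in atTop, c * n ≤ tally IsRequest ω n := by
  have hbound : ∀ z : Period, |unitReward IsRequest z.state z.event| ≤ 1 := fun z => by
    unfold unitReward
    split <;> simp
  have hpos : ∀ y', 0 < ∫ z, unitReward IsRequest z.state z.event ∂r.periodLaw y' := fun y' => by
    have hrate : ∫ z, unitReward IsRequest z.state z.event ∂r.periodLaw y'
        = r.lam / r.totalRate y' := by
      rw [integral_periodLaw, integral_eventLaw]
      simp [unitReward, IsRequest, rate]
    exact hrate ▸ div_pos r.lam_pos (r.totalRate_pos y')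
  filter_upwards [r.ae_exists_eventually_mul_le_sum y
    (Period.measurable_comp_state_event (unitReward IsRequest)) hbound hpos] with ω hω
  simpa only [sum_unitReward] using hω

lemma Rates.ae_eventually_tally_isRequest_pos (r : Rates) (y : State) :
    ∀ᵐ ω ∂r.law y, ∀ᶠ n in atTop, 0 < tally IsRequest ω n := by
  filter_upwards [r.ae_exists_eventually_mul_le_tally_isRequest y] with ω ⟨c, hc, hω⟩
  filter_upwards [hω, eventually_gt_atTop 0] with n hn hn0
  exact Nat.cast_pos.1 ((mul_pos hc (Nat.cast_pos.2 hn0)).trans_le hn)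

theorem Rates.not_recurrent (r : Rates) (hr : r.mu = 0) : ¬ r.Recurrent := by
  intro hrec
  obtain ⟨ω, hback, hω, hs, hlim, hreq⟩ := ((hrec start).and <| (r.ae_isTrajectory start).and <|
    (r.ae_event_ne_sample hr start).and <| (r.ae_tendsto_epoch start).and <|
      r.ae_eventually_tally_isRequest_pos start).exists
  obtain ⟨T, hT⟩ := eventually_atTop.1 ((hω.tendsto_numEvents hlim).eventually hreq)
  obtain ⟨t, ht, hstart⟩ := hback T
  have haccepts : Accepts (ω (numEvents ω t)).state :=
    (congrArg Accepts hstart).mpr (rfl : Accepts start)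
  exact (hT t ht).ne' ((hω.accepts_state_iff rfl hs _).1 haccepts)

end SingleAcceptance

section Ratios

variable (r : Rates) {y : State} {ω : ℕ → Period}

/-- The probability, as a function of the state, that a false acceptance is still to come: with
`X̂ = 0` it happens if and only if the next request finds the machine busy. Rows are indexed
by `X` and columns by `X̂`; the entries outside the state space are placeholders. -/
def Rates.acceptancePotential (y : State) : ℝ :=
  ![![r.alpha / r.kappa, 0, 0], ![(r.lam + r.alpha) / r.kappa, 0, 0], ![0, 0, 0]] y.1.1 y.1.2

/-- The asymptotic advantage, as a function of the state, in the number of false rejections over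
the fraction `β / (α + β)` of all rejections, relative to a rejecting RA and a machine
busy with an internal job. The entries are indexed as in `acceptancePotential`. -/
def Rates.rejectionPotential (y : State) : ℝ :=
  let c := r.lam / (r.alpha + r.beta) - r.beta * r.lam / (r.gamma * (r.alpha + r.beta))
  ![![(r.lam + r.beta) / r.kappa * c, r.lam / (r.alpha + r.beta), r.lam / (r.alpha + r.beta)],
    ![r.beta / r.kappa * c, 0, 0], ![0, 0, c]] y.1.1 y.1.2

lemma Rates.kappa_pos : 0 < r.kappa := add_pos (add_pos r.lam_pos r.alpha_pos) r.beta_pos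

lemma Rates.solvesPoisson_acceptancePotential (hr : r.mu = 0) :
    r.SolvesPoisson (unitReward IsFalseAcceptance) r.acceptancePotential 0 := by
  rintro ⟨⟨x, z⟩, hy⟩
  have hk := r.kappa_pos.ne'
  rw [integral_eventLaw, div_eq_zero_iff]
  left
  fin_cases x <;> fin_cases z <;>
    simp [unitReward, IsFalseAcceptance, acceptancePotential, step, rate, internalRate, Accepts,
      Free, hr] at hy ⊢
  all_goals
    field_simp
    simp only [kappa]
    ring

lemma Rates.solvesPoisson_rejectionPotential (hr : r.mu = 0) :
    r.SolvesPoisson (fun y e => unitReward IsFalseRejection y e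
      - r.beta / (r.alpha + r.beta) * unitReward IsRejection y e) r.rejectionPotential 0 := by
  rintro ⟨⟨x, z⟩, hy⟩
  have hk := r.kappa_pos.ne'
  have hg := r.gamma_pos.ne'
  have hab := (add_pos r.alpha_pos r.beta_pos).ne'
  rw [integral_eventLaw, div_eq_zero_iff]
  left
  fin_cases x <;> fin_cases z <;>
    simp [unitReward, IsFalseRejection, IsRejection, rejectionPotential, step, rate, internalRate,
      Accepts, Free, hr] at hy ⊢
  all_goals
    field_simp
    try simp only [kappa]
    try ring

lemma Rates.acceptancePotential_of_not_accepts (hy : ¬ Accepts y) :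
    r.acceptancePotential y = 0 := by
  obtain ⟨⟨x, z⟩, _⟩ := y
  fin_cases x <;> fin_cases z <;> simp [acceptancePotential, Accepts] at hy ⊢

lemma IsTrajectory.tally_isFalseAcceptance_le_one (hω : IsTrajectory y ω) (hy : Accepts y)
    (hs : ∀ n, (ω n).event ≠ .sample) (n : ℕ) : tally IsFalseAcceptance ω n ≤ 1 :=
  (tally_mono fun _ _ h => ⟨h.1, h.2.1⟩).trans <|
    (hω.tally_isAcceptance_eq_min hy hs n).trans_le (min_le_right _ _)

lemma IsTrajectory.tendsto_tally_isFalseAcceptance (hω : IsTrajectory y ω) (hy : Accepts y)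
    (hs : ∀ n, (ω n).event ≠ .sample) (hlim : Tendsto (epoch ω) atTop atTop)
    (hreq : ∀ᶠ n in atTop, 0 < tally IsRequest ω n) :
    Tendsto (fun n => (tally IsFalseAcceptance ω n : ℝ)) atTop (𝓝 (limsupFA ω)) := by
  have hmono : Monotone fun n => (tally IsFalseAcceptance ω n : ℝ) :=
    Nat.mono_cast.comp (tally_monotone _ _)
  have hconv := tendsto_atTop_ciSup hmono ⟨1, Set.forall_mem_range.2 fun n =>
    Nat.cast_le_one.2 (hω.tally_isFalseAcceptance_le_one hy hs n)⟩
  have hratio : Tendsto (fun n => (tally IsFalseAcceptance ω n / tally IsAcceptance ω n : ℝ))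
      atTop (𝓝 (⨆ n, (tally IsFalseAcceptance ω n : ℝ))) := by
    refine hconv.congr' (hreq.mono fun n hn => ?_)
    simp only [hω.tally_isAcceptance_eq_min hy hs, min_eq_right (Nat.succ_le_of_lt hn),
      Nat.cast_one, div_one]
  have hlimsup := hω.limsup_count_div_count hlim hratio
  rwa [← hlimsup] at hconv

theorem Rates.integrable_limsupFA_and_FAR_eq (hr : r.mu = 0) :
    Integrable limsupFA (r.law start) ∧ r.FAR = r.alpha / r.kappa := by
  refine (r.solvesPoisson_acceptancePotential hr).integrable_and_integral_eq_of_tendsto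
    (C := 1) ?_ ?_
  · filter_upwards [r.ae_isTrajectory start, r.ae_event_ne_sample hr start] with ω hω hs n
    rw [sum_unitReward, Nat.abs_cast]
    exact Nat.cast_le_one.2 (hω.tally_isFalseAcceptance_le_one rfl hs n)
  · filter_upwards [r.ae_isTrajectory start, r.ae_event_ne_sample hr start,
      r.ae_tendsto_epoch start, r.ae_eventually_tally_isRequest_pos start] with ω hω hs hlim hreq
    refine (hω.tendsto_tally_isFalseAcceptance rfl hs hlim hreq).congr' ?_
    filter_upwards [hreq] with n hn
    rw [sum_unitReward, r.acceptancePotential_of_not_accepts fun h =>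
      hn.ne' ((hω.accepts_state_iff rfl hs n).1 h), add_zero]

lemma IsTrajectory.isBigO_tally_isRejection (hω : IsTrajectory y ω) (hy : Accepts y)
    (hs : ∀ n, (ω n).event ≠ .sample) {c : ℝ} (hc : 0 < c)
    (hreq : ∀ᶠ n : ℕ in atTop, c * n ≤ tally IsRequest ω n) :
    (fun n : ℕ => (n : ℝ)) =O[atTop] fun n => (tally IsRejection ω n : ℝ) := by
  refine Asymptotics.IsBigO.of_bound (2 / c) ?_
  filter_upwards [hreq, tendsto_natCast_atTop_atTop.eventually_ge_atTop (2 / c)] with n hn hn2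
  have hrej : tally IsRequest ω n ≤ 1 + tally IsRejection ω n := by
    rw [tally_isRequest_eq_add, hω.tally_isAcceptance_eq_min hy hs]
    exact Nat.add_le_add_right (min_le_right _ _) _
  have hrej' : (tally IsRequest ω n : ℝ) ≤ 1 + tally IsRejection ω n := mod_cast hrej
  rw [div_le_iff₀ hc] at hn2
  rw [Real.norm_natCast, Real.norm_natCast, div_mul_eq_mul_div, le_div_iff₀ hc]
  linarith

lemma Rates.ae_limsupFR_eq (hr : r.mu = 0) :
    ∀ᵐ ω ∂r.law start, limsupFR ω = r.beta / (r.alpha + r.beta) := by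
  filter_upwards [(r.solvesPoisson_rejectionPotential hr).ae_tendsto_average start,
    r.ae_isTrajectory start, r.ae_event_ne_sample hr start, r.ae_tendsto_epoch start,
    r.ae_exists_eventually_mul_le_tally_isRequest start] with ω havg hω hs hlim ⟨c, hc, hreq⟩
  simp only [Finset.sum_sub_distrib, ← Finset.mul_sum, sum_unitReward] at havg
  have hratio :=
    tendsto_div_of_average_sub_mul havg (hω.isBigO_tally_isRejection rfl hs hc hreq)
  exact (hω.limsup_count_div_count hlim hratio :)

theorem Rates.integrable_limsupFR_and_FRR_eq (hr : r.mu = 0) :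
    Integrable limsupFR (r.law start) ∧ r.FRR = r.beta / (r.alpha + r.beta) := by
  have h := r.ae_limsupFR_eq hr
  exact ⟨(integrable_congr h).2 (integrable_const _), by simp [FRR, integral_congr_ae h]⟩

end Ratios

section ClosedForms

variable (r : Rates)

lemma Rates.tendsto_closedFAR : Tendsto r.closedFAR (𝓝[>] 0) (𝓝 (r.alpha / r.kappa)) := by
  have hcont : ContinuousAt r.closedFAR 0 :=
    continuousAt_const.div (continuousAt_id.add continuousAt_const)
      (by simpa using r.kappa_pos.ne')
  have hzero : r.closedFAR 0 = r.alpha / r.kappa := by simp [closedFAR]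
  exact hzero ▸ hcont.tendsto.mono_left nhdsWithin_le_nhds

lemma Rates.tendsto_closedFRR :
    Tendsto r.closedFRR (𝓝[>] 0) (𝓝 (r.beta / (r.alpha + r.beta))) := by
  have hα := r.alpha_pos
  have hβ := r.beta_pos
  have hγ := r.gamma_pos
  have hlam := r.lam_pos
  have hκ := r.kappa_pos
  have hcont : ContinuousAt r.closedFRR 0 := by
    refine ContinuousAt.div (by fun_prop) (by fun_prop) ?_
    simp only [mul_zero, zero_add, ne_eq, OfNat.ofNat_ne_zero, not_false_eq_true, zero_pow]
    positivity
  have hzero : r.closedFRR 0 = r.beta / (r.alpha + r.beta) := by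
    simp only [closedFRR, mul_zero, zero_add, zero_mul, ne_eq, OfNat.ofNat_ne_zero,
      not_false_eq_true, zero_pow]
    field_simp
    ring
  exact hzero ▸ hcont.tendsto.mono_left nhdsWithin_le_nhds

end ClosedForms

end MarkovMachine

end

theorem theorem2 (r : MarkovMachine.Rates) (hr : r.mu = 0) :
    ¬ r.Recurrent ∧
    Integrable MarkovMachine.limsupFA (r.law MarkovMachine.start) ∧
    Integrable MarkovMachine.limsupFR (r.law MarkovMachine.start) ∧
    Tendsto r.closedFAR (𝓝[>] 0) (𝓝 r.FAR) ∧
    Tendsto r.closedFRR (𝓝[>] 0) (𝓝 r.FRR) ∧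
    r.FAR = r.alpha / (r.lam + r.alpha + r.beta) ∧
    r.FRR = r.beta / (r.alpha + r.beta) := by
  obtain ⟨hintFA, hFAR⟩ := r.integrable_limsupFA_and_FAR_eq hr
  obtain ⟨hintFR, hFRR⟩ := r.integrable_limsupFR_and_FRR_eq hr
  refine ⟨r.not_recurrent hr, hintFA, hintFR, ?_, ?_, hFAR, hFRR⟩
  · exact hFAR ▸ r.tendsto_closedFAR
  · exact hFRR ▸ r.tendsto_closedFRR
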